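/- Let $\Lambda$ be a countable index set, $M\in\mathbb N$, and let $\ell_2(\Lambda,\mathbb R^M)$ be the Hilbert space of families $u=(u_\lambda)_{\lambda\in\Lambda}$, $u_\lambda\in\mathbb R^M$, with $\|u\|_2^2=\sum_\lambda\|u_\lambda\|_2^2<\infty$. Let $T:\ell_2(\Lambda,\mathbb R^M)\to\mathcal H$ be a bounded linear operator into a real Hilbert space $\mathcal H$ with $\|T\|<1$, and let $g\in\mathcal H$. Let $1\le q\le\infty$, let $v_\lambda\ge 0$ and $\omega_\lambda\ge 0$ $(\lambda\in\Lambda)$ be real weights, and put, with values in $[0,\infty]$, $$\Psi(u)=\sum_{\lambda\in\Lambda}v_\lambda\|u_\lambda\|_q+\sum_{\lambda\in\Lambda}\omega_\lambda\|u_\lambda\|_2^2,\qquad K(u)=\|Tu-g\|_{\mathcal H}^2+\Psi(u),\qquad u\in\ell_2(\Lambda,\mathbb R^M).$$ Assume that $(v_\lambda)$ or $(\omega_\lambda)$ is bounded away from $0$ (that is, bounded below by a positive constant). In case $(v_\lambda)$ is not bounded away from $0$, assume further that there is a constant $c>0$ such that $v_\lambda<c$ for only finitely many $\lambda$. Then the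 thresholding operator $$U_\Psi(x)=\operatorname*{arg\,min}_{z\in\ell_2(\Lambda,\mathbb R^M)}\ \|x-z\|_2^2+\Psi(z),\qquad x\in\ell_2(\Lambda,\mathbb R^M),$$ is well defined (the minimizer exists and is unique), and for every $u^{(0)}\in\ell_2(\Lambda,\mathbb R^M)$ the thresholded Landweber iterates $$u^{(m+1)}=U_\Psi\bigl(u^{(m)}+T^*(g-Tu^{(m)})\bigr),\qquad m\ge 0,$$ converge in the norm of $\ell_2(\Lambda,\mathbb R^M)$ to a minimizer of $K$. -/

import Mathlib

open scoped ENNReal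

noncomputable section

namespace JointSparsity

/-- The space `ℓ₂(Λ, ℝ^M)`, where `ℝ^M` carries the Euclidean norm. -/
abbrev Coeff (Λ : Type*) (M : ℕ) : Type _ :=
  lp (fun _ : Λ => EuclideanSpace ℝ (Fin M)) 2

/-- The `ℓ_q` norm of a vector of `ℝ^M`, `1 ≤ q ≤ ∞`. -/
def qNorm {M : ℕ} (q : ℝ≥0∞) (x : EuclideanSpace ℝ (Fin M)) : ℝ :=
  ‖(WithLp.toLp q (WithLp.ofLp x) : PiLp q (fun _ : Fin M => ℝ))‖

/-- The sparsity measure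
`Ψ(u) = ∑_λ v_λ ‖u_λ‖_q + ∑_λ ω_λ ‖u_λ‖₂²`, with values in `[0, ∞]`. -/
def Psi {Λ : Type*} {M : ℕ} (q : ℝ≥0∞) (v ω : Λ → ℝ) (u : Coeff Λ M) : ℝ≥0∞ :=
  (∑' l, ENNReal.ofReal (v l * qNorm q (u l))) + ∑' l, ENNReal.ofReal (ω l * ‖u l‖ ^ 2)

/-- The functional `K(u) = ‖T u - g‖² + Ψ(u)`, with values in `[0, ∞]`. -/
def K {Λ : Type*} {M : ℕ} {H : Type*} [NormedAddCommGroup H] [InnerProductSpace ℝ H]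
    (q : ℝ≥0∞) (v ω : Λ → ℝ) (T : Coeff Λ M →L[ℝ] H) (g : H) (u : Coeff Λ M) : ℝ≥0∞ :=
  ENNReal.ofReal (‖T u - g‖ ^ 2) + Psi q v ω u

/-- The functional `z ↦ ‖x - z‖² + Ψ(z)` whose minimizer is the thresholding of `x`. -/
def proxFunctional {Λ : Type*} {M : ℕ} (q : ℝ≥0∞) (v ω : Λ → ℝ) (x z : Coeff Λ M) : ℝ≥0∞ :=
  ENNReal.ofReal (‖x - z‖ ^ 2) + Psi q v ω z

/-- The thresholding operator `U_Ψ(x) = argmin_z ‖x - z‖² + Ψ(z)`. -/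
def threshold {Λ : Type*} {M : ℕ} (q : ℝ≥0∞) (v ω : Λ → ℝ) (x : Coeff Λ M) : Coeff Λ M :=
  Classical.epsilon fun z => IsMinOn (proxFunctional q v ω x) Set.univ z

/-- The thresholded Landweber iterates
`u⁽⁰⁾ = u0`, `u⁽ᵐ⁺¹⁾ = U_Ψ(u⁽ᵐ⁾ + T*(g - T u⁽ᵐ⁾))`. -/
def iterate {Λ : Type*} {M : ℕ} {H : Type*} [NormedAddCommGroup H] [InnerProductSpace ℝ H]
    [CompleteSpace H] (q : ℝ≥0∞) (v ω : Λ → ℝ) (T : Coeff Λ M →L[ℝ] H) (g : H)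
    (u0 : Coeff Λ M) : ℕ → Coeff Λ M
  | 0 => u0
  | m + 1 =>
    threshold q v ω
      (iterate q v ω T g u0 m +
        ContinuousLinearMap.adjoint T (g - T (iterate q v ω T g u0 m)))

/-- A real sequence indexed by `Λ` is bounded away from `0` (from below). -/
def BoundedAwayFromZero {Λ : Type*} (w : Λ → ℝ) : Prop :=
  ∃ c : ℝ, 0 < c ∧ ∀ l, c ≤ w l

end JointSparsity

end

/-! Up to a constant, `‖u + T*(g - Tu) - z‖² + Ψ(z)` is `K(z) + ‖z - u‖² - ‖T(z - u)‖²`. Quadratic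
growth at its minimizer `u'`, tested at a minimizer `uStar` of `K`, gives `landweber_step`: the
squared distance to `uStar` drops by at least `(1 - ‖T‖²)‖u' - u‖² + ‖T(u - uStar)‖²`, plus `γ‖u' -
uStar‖²` if `Ψ` is `γ`-strongly convex.

If `ω ≥ γ > 0`, the last term alone forces norm convergence.

If `v` is bounded below, the other two terms show that the residuals of the thresholding steps
converge in norm to `p = T*(g - T uStar)`. Outside a finite set `S` the tail of `p` is small,
whereas a nonzero tail of an iterate costs at least `c` times its norm in `Ψ`; so late iterates live
on `S` (`truncate_eq_of_isMinOn_proxFunctional`). Compactness in finite dimension yields a cluster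
point, which minimizes `K`, and monotonicity of distances to minimizers upgrades the subsequence to
the whole sequence. -/

namespace JointSparsity

/-! ### Strongly convex functionals on a Hilbert space and the Landweber step -/

section Abstract

variable {E H : Type*} [NormedAddCommGroup E] [InnerProductSpace ℝ E]
  [NormedAddCommGroup H] [InnerProductSpace ℝ H]

/-- Strong convexity with modulus `γ` (plain convexity when `γ = 0`) of a functional with values
in `[0, ∞]`. -/
def StronglyConvex (γ : ℝ) (F : E → ℝ≥0∞) : Prop :=
  ∀ (a b : E) (t : ℝ), 0 ≤ t → t ≤ 1 →
    F ((1 - t) • a + t • b) + ENNReal.ofReal (γ * (t * (1 - t)) * ‖a - b‖ ^ 2) ≤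
      ENNReal.ofReal (1 - t) * F a + ENNReal.ofReal t * F b

theorem StronglyConvex.add {γ δ : ℝ} {F G : E → ℝ≥0∞} (hγ : 0 ≤ γ) (hδ : 0 ≤ δ)
    (hF : StronglyConvex γ F) (hG : StronglyConvex δ G) :
    StronglyConvex (γ + δ) fun u => F u + G u := by
  intro a b t h0 h1
  have ht : 0 ≤ t * (1 - t) := mul_nonneg h0 (by linarith)
  rw [add_mul, add_mul, ENNReal.ofReal_add (by positivity) (by positivity)]
  calc _ = (F ((1 - t) • a + t • b) + ENNReal.ofReal (γ * (t * (1 - t)) * ‖a - b‖ ^ 2)) +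
      (G ((1 - t) • a + t • b) + ENNReal.ofReal (δ * (t * (1 - t)) * ‖a - b‖ ^ 2)) := add_add_add_comm _ _ _ _
    _ ≤ _ := add_le_add (hF a b t h0 h1) (hG a b t h0 h1)
    _ = _ := by ring

theorem StronglyConvex.convex_sublevel {γ : ℝ} {F : E → ℝ≥0∞} (hF : StronglyConvex γ F)
    (r : ℝ≥0∞) : Convex ℝ {u | F u ≤ r} := by
  intro a ha b hb s t hs ht hst
  obtain rfl : s = 1 - t := by linarith
  calc F ((1 - t) • a + t • b) ≤ _ := le_self_add
    _ ≤ _ := hF a b t ht (by linarith)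
    _ ≤ ENNReal.ofReal (1 - t) * r + ENNReal.ofReal t * r := by gcongr <;> assumption
    _ = r := by
      rw [← add_mul, ← ENNReal.ofReal_add hs ht, hst, ENNReal.ofReal_one, one_mul]

theorem norm_sq_convex_combination (a b : E) (t : ℝ) :
    ‖(1 - t) • a + t • b‖ ^ 2 + t * (1 - t) * ‖a - b‖ ^ 2 =
      (1 - t) * ‖a‖ ^ 2 + t * ‖b‖ ^ 2 := by
  rw [norm_add_sq_real, norm_sub_sq_real, norm_smul, norm_smul, real_inner_smul_left,
    real_inner_smul_right, mul_pow, mul_pow, Real.norm_eq_abs, Real.norm_eq_abs, sq_abs, sq_abs]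
  ring

theorem stronglyConvex_norm_sub_sq (x : E) :
    StronglyConvex 1 fun z => ENNReal.ofReal (‖x - z‖ ^ 2) := by
  intro a b t h0 h1
  have h1' : 0 ≤ 1 - t := by linarith
  have key := norm_sq_convex_combination (x - a) (x - b) t
  rw [show (1 - t) • (x - a) + t • (x - b) = x - ((1 - t) • a + t • b) by module,
    sub_sub_sub_cancel_left, norm_sub_rev b a] at key
  simp only
  rw [← ENNReal.ofReal_mul h1', ← ENNReal.ofReal_mul h0,
    ← ENNReal.ofReal_add (by positivity) (by positivity),
    ← ENNReal.ofReal_add (by positivity) (by positivity), one_mul, key]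

theorem stronglyConvex_norm_map_sub_sq (T : E →L[ℝ] H) (g : H) :
    StronglyConvex 0 fun z => ENNReal.ofReal (‖T z - g‖ ^ 2) := by
  intro a b t h0 h1
  have key := stronglyConvex_norm_sub_sq g (T a) (T b) t h0 h1
  simp only [norm_sub_rev g] at key
  simp only [map_add, map_smul, zero_mul, ENNReal.ofReal_zero, add_zero]
  exact le_self_add.trans key

/-- No weak compactness is needed. The points of least norm in the nested closed convex sublevel
sets `F ≤ inf F + 1/(n+1)` have increasing bounded norms, and the Pythagorean inequality for
projections makes them Cauchy; the limit lies in every sublevel set. -/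
theorem exists_isMinOn_of_convex [CompleteSpace E] {F : E → ℝ≥0∞} (hlsc : LowerSemicontinuous F)
    (hconv : ∀ r, Convex ℝ {u | F u ≤ r}) {a : E} (ha : F a ≠ ∞)
    (hbdd : ∀ r : ℝ≥0∞, r ≠ ∞ → ∃ R : ℝ, ∀ u, F u ≤ r → ‖u‖ ≤ R) :
    ∃ z, IsMinOn F Set.univ z := by
  set m : ℝ≥0∞ := ⨅ u, F u with hm
  have hmtop : m ≠ ∞ := ne_top_of_le_ne_top ha (iInf_le _ _)
  let r : ℕ → ℝ≥0∞ := fun n => m + ((n : ℝ≥0∞) + 1)⁻¹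
  let C : ℕ → Set E := fun n => {u | F u ≤ r n}
  have hC : ∀ n, ∃ p ∈ C n, ∀ w ∈ C n, ‖w - p‖ ^ 2 + ‖p‖ ^ 2 ≤ ‖w‖ ^ 2 := by
    intro n
    have hne : (C n).Nonempty := by
      have : m < r n := ENNReal.lt_add_right hmtop (by simp)
      obtain ⟨u, hu⟩ := iInf_lt_iff.1 this
      exact ⟨u, hu.le⟩
    obtain ⟨p, hp, hmin⟩ := exists_norm_eq_iInf_of_complete_convex hne
      (hlsc.isClosed_preimage (r n)).isComplete (hconv (r n)) 0
    refine ⟨p, hp, fun w hw => ?_⟩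
    have h := (norm_eq_iInf_iff_real_inner_le_zero (hconv (r n)) hp).1 hmin w hw
    rw [zero_sub, inner_neg_left] at h
    have e : ‖w‖ ^ 2 = ‖p + (w - p)‖ ^ 2 := by rw [add_sub_cancel]
    rw [norm_add_sq_real] at e
    linarith
  choose p hp hpw using hC
  have hCanti : ∀ {k n}, k ≤ n → C n ⊆ C k := by
    intro k n hkn u hu
    refine le_trans (show F u ≤ r n from hu) ?_
    simp only [r]
    gcongr
  have hr0 : r 0 ≠ ∞ := by simp [r, hmtop]
  obtain ⟨R, hR⟩ := hbdd _ hr0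
  have hmono : Monotone fun n => ‖p n‖ ^ 2 := by
    intro k n hkn
    have := hpw k (p n) (hCanti hkn (hp n))
    simp only
    nlinarith [sq_nonneg ‖p n - p k‖]
  have hbd : BddAbove (Set.range fun n => ‖p n‖ ^ 2) := by
    refine ⟨R ^ 2, ?_⟩
    rintro _ ⟨n, rfl⟩
    exact pow_le_pow_left₀ (norm_nonneg _) (hR _ (hCanti (Nat.zero_le n) (hp n))) 2
  have hlim := tendsto_atTop_ciSup hmono hbd
  have hcauchy : CauchySeq p := by
    rw [Metric.cauchySeq_iff']
    intro ε hε
    obtain ⟨N, hN⟩ := (hlim.eventually (lt_mem_nhds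
      (sub_lt_self (⨆ n, ‖p n‖ ^ 2) (pow_pos hε 2)))).exists
    refine ⟨N, fun n hn => ?_⟩
    rw [dist_eq_norm]
    have h1 := hpw N (p n) (hCanti hn (hp n))
    have h2 := le_ciSup hbd n
    exact lt_of_pow_lt_pow_left₀ 2 hε.le (by linarith)
  obtain ⟨z, hz⟩ := cauchySeq_tendsto_of_complete hcauchy
  refine ⟨z, fun u _ => ?_⟩
  have hzC : ∀ n, F z ≤ r n := fun n =>
    (hlsc.isClosed_preimage (r n)).mem_of_tendsto hz
      (Filter.eventually_atTop.2 ⟨n, fun k hk => hCanti hk (hp k)⟩)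
  have hrl : Filter.Tendsto r Filter.atTop (nhds (m + 0)) := by
    refine tendsto_const_nhds.add ?_
    have := (Filter.tendsto_add_atTop_iff_nat 1).2 ENNReal.tendsto_inv_nat_nhds_zero
    simpa using this
  exact (ge_of_tendsto' hrl hzC).trans (by rw [add_zero]; exact iInf_le _ _)

/-- Quadratic growth of a strongly convex functional at a minimizer. -/
theorem StronglyConvex.growth {γ : ℝ} (hγ : 0 ≤ γ) {F : E → ℝ≥0∞} (hF : StronglyConvex γ F)
    {z : E} (hz : IsMinOn F Set.univ z) (hzt : F z ≠ ∞) (w : E) :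
    F z + ENNReal.ofReal (γ * ‖w - z‖ ^ 2) ≤ F w := by
  by_cases hw : F w = ∞
  · simp [hw]
  rw [← ENNReal.ofReal_toReal hzt, ← ENNReal.ofReal_toReal hw,
    ← ENNReal.ofReal_add ENNReal.toReal_nonneg (by positivity)]
  apply ENNReal.ofReal_le_ofReal
  -- Compare `F z` with `F` on the segment towards `w`, divide by `t`, then let `t` tend to `0`.
  have key : ∀ t ∈ Set.Ioo (0 : ℝ) 1,
      (F z).toReal + γ * (1 - t) * ‖w - z‖ ^ 2 ≤ (F w).toReal := by
    rintro t ⟨h0, h1⟩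
    have h1' : 0 ≤ 1 - t := by linarith
    have h := (add_le_add_left (isMinOn_iff.1 hz ((1 - t) • z + t • w) trivial) _).trans
      (hF z w t h0.le h1.le)
    rw [← ENNReal.ofReal_toReal hzt, ← ENNReal.ofReal_toReal hw,
      ← ENNReal.ofReal_add ENNReal.toReal_nonneg (by positivity),
      ← ENNReal.ofReal_mul h1', ← ENNReal.ofReal_mul h0.le,
      ← ENNReal.ofReal_add (by positivity) (by positivity),
      ENNReal.ofReal_le_ofReal_iff (by positivity), norm_sub_rev z w] at h
    refine le_of_mul_le_mul_left ?_ h0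
    linarith
  have hlim : Filter.Tendsto (fun t : ℝ => (F z).toReal + γ * (1 - t) * ‖w - z‖ ^ 2)
      (nhdsWithin 0 (Set.Ioi 0)) (nhds ((F z).toReal + γ * (1 - 0) * ‖w - z‖ ^ 2)) :=
    (Continuous.tendsto (by fun_prop) 0).mono_left nhdsWithin_le_nhds
  rw [sub_zero, mul_one] at hlim
  refine le_of_tendsto hlim ?_
  filter_upwards [Ioo_mem_nhdsGT (zero_lt_one' ℝ)] with t ht using key t ht

theorem StronglyConvex.isMinOn_unique {γ : ℝ} (hγ : 0 < γ) {F : E → ℝ≥0∞}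
    (hF : StronglyConvex γ F) {z w : E} (hz : IsMinOn F Set.univ z) (hw : IsMinOn F Set.univ w)
    (hzt : F z ≠ ∞) : w = z := by
  have h := (hF.growth hγ.le hz hzt w).trans (isMinOn_iff.1 hw z trivial)
  have h0 : ENNReal.ofReal (γ * ‖w - z‖ ^ 2) ≤ 0 :=
    (ENNReal.add_le_add_iff_left hzt).1 (by simpa using h)
  have h1 : γ * ‖w - z‖ ^ 2 ≤ 0 := by simpa using h0
  have h2 : ‖w - z‖ ^ 2 ≤ 0 := by nlinarith
  exact sub_eq_zero.1 (norm_eq_zero.1 (pow_eq_zero_iff two_ne_zero |>.1 (h2.antisymm (sq_nonneg _))))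

/-- The surrogate identity behind the Landweber iteration. -/
theorem norm_landweber_sub_sq [CompleteSpace E] [CompleteSpace H] (T : E →L[ℝ] H) (g : H)
    (u z : E) :
    ‖u + ContinuousLinearMap.adjoint T (g - T u) - z‖ ^ 2 =
      ‖z - u‖ ^ 2 - ‖T (z - u)‖ ^ 2 + ‖T z - g‖ ^ 2 +
        (‖ContinuousLinearMap.adjoint T (g - T u)‖ ^ 2 - ‖g - T u‖ ^ 2) := by
  rw [show u + ContinuousLinearMap.adjoint T (g - T u) - z =
      ContinuousLinearMap.adjoint T (g - T u) - (z - u) by abel,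
    show T z - g = T (z - u) - (g - T u) by rw [map_sub]; abel,
    norm_sub_sq_real, norm_sub_sq_real (T (z - u)),
    ContinuousLinearMap.adjoint_inner_left, real_inner_comm]
  ring

/-- One step of the thresholded Landweber iteration, compared with a minimizer `uStar` of the
functional `u ↦ ‖T u - g‖² + Ψ(u)`. -/
theorem landweber_step [CompleteSpace E] [CompleteSpace H] {γ : ℝ} (hγ : 0 ≤ γ)
    {Ψ : E → ℝ≥0∞} (hΨ : StronglyConvex γ Ψ) (T : E →L[ℝ] H) (hT : ‖T‖ < 1) (g : H)
    {u u' uStar : E}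
    (hu' : IsMinOn (fun z => ENNReal.ofReal
      (‖u + ContinuousLinearMap.adjoint T (g - T u) - z‖ ^ 2) + Ψ z) Set.univ u')
    (hs : IsMinOn (fun z => ENNReal.ofReal (‖T z - g‖ ^ 2) + Ψ z) Set.univ uStar)
    (hst : Ψ uStar ≠ ∞) :
    Ψ u' ≠ ∞ ∧
    (1 + γ) * ‖u' - uStar‖ ^ 2 + (1 - ‖T‖ ^ 2) * ‖u' - u‖ ^ 2 + ‖T (u - uStar)‖ ^ 2 ≤
      ‖u - uStar‖ ^ 2 ∧
    ENNReal.ofReal (‖T u' - g‖ ^ 2) + Ψ u' ≤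
      ENNReal.ofReal (‖T uStar - g‖ ^ 2) + Ψ uStar +
        ENNReal.ofReal (‖u - uStar‖ ^ 2 - ‖u' - uStar‖ ^ 2) := by
  have hfin : Ψ u' ≠ ∞ := by
    have h := isMinOn_iff.1 hu' uStar trivial
    exact (ENNReal.add_ne_top.1 (ne_top_of_le_ne_top (by simp [hst]) h)).2
  have h1 := ((stronglyConvex_norm_sub_sq
    (u + ContinuousLinearMap.adjoint T (g - T u))).add zero_le_one hγ hΨ).growth
      (by positivity) hu' (by simp [hfin]) uStar
  -- Once `h1` is rewritten by the surrogate identity, adding `h2` cancels the values of `K` and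
  -- leaves the distance estimate; `h1` alone bounds the value of `K` at `u'`.
  have h2 := isMinOn_iff.1 hs u' trivial
  rw [← ENNReal.ofReal_toReal hfin, ← ENNReal.ofReal_toReal hst] at h1 h2 ⊢
  set a := (Ψ u').toReal
  set b := (Ψ uStar).toReal
  have ha : 0 ≤ a := ENNReal.toReal_nonneg
  have hb : 0 ≤ b := ENNReal.toReal_nonneg
  rw [← ENNReal.ofReal_add (by positivity) ha, ← ENNReal.ofReal_add (by positivity) hb,
    ← ENNReal.ofReal_add (by positivity) (by positivity),
    ENNReal.ofReal_le_ofReal_iff (by positivity), norm_landweber_sub_sq,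
    norm_landweber_sub_sq, norm_sub_rev uStar, norm_sub_rev uStar, map_sub T uStar u,
    norm_sub_rev (T uStar), ← map_sub] at h1
  rw [← ENNReal.ofReal_add (by positivity) ha, ← ENNReal.ofReal_add (by positivity) hb,
    ENNReal.ofReal_le_ofReal_iff (by positivity)] at h2
  have h3 : ‖T (u' - u)‖ ^ 2 ≤ ‖T‖ ^ 2 * ‖u' - u‖ ^ 2 := by
    rw [← mul_pow]
    exact pow_le_pow_left₀ (norm_nonneg _) (T.le_opNorm _) 2
  have h4 : 0 ≤ (1 - ‖T‖ ^ 2) * ‖u' - u‖ ^ 2 := by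
    refine mul_nonneg ?_ (sq_nonneg _)
    nlinarith [norm_nonneg T]
  have h5 : 0 ≤ γ * ‖u' - uStar‖ ^ 2 := by positivity
  have h6 := sq_nonneg ‖T (u - uStar)‖
  refine ⟨ENNReal.ofReal_ne_top, by linarith, ?_⟩
  rw [← ENNReal.ofReal_add (by positivity) ha, ← ENNReal.ofReal_add (by positivity) hb,
    ← ENNReal.ofReal_add (by positivity) (by linarith)]
  exact ENNReal.ofReal_le_ofReal (by linarith)

end Abstract

end JointSparsity

/-! ### The sparsity measure on `ℓ₂(Λ, ℝ^M)` and truncation to finite sets -/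

namespace JointSparsity

section Concrete

variable {Λ : Type*} {M : ℕ}

theorem continuous_coeff_apply (l : Λ) : Continuous fun u : Coeff Λ M => u l := by
  refine LipschitzWith.continuous (K := 1) (LipschitzWith.of_dist_le_mul fun u w => ?_)
  rw [dist_eq_norm, dist_eq_norm, NNReal.coe_one, one_mul]
  exact lp.norm_apply_le_norm two_ne_zero (u - w) l

theorem qNorm_nonneg {q : ℝ≥0∞} (hq : 1 ≤ q) (x : EuclideanSpace ℝ (Fin M)) : 0 ≤ qNorm q x := by
  have : Fact (1 ≤ q) := ⟨hq⟩
  exact norm_nonneg _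

theorem qNorm_zero {q : ℝ≥0∞} (hq : 1 ≤ q) : qNorm q (0 : EuclideanSpace ℝ (Fin M)) = 0 := by
  have : Fact (1 ≤ q) := ⟨hq⟩
  simp [qNorm]

theorem continuous_qNorm {q : ℝ≥0∞} (hq : 1 ≤ q) :
    Continuous (qNorm q : EuclideanSpace ℝ (Fin M) → ℝ) := by
  have : Fact (1 ≤ q) := ⟨hq⟩
  unfold qNorm
  fun_prop

theorem qNorm_convex_combination {q : ℝ≥0∞} (hq : 1 ≤ q) (a b : EuclideanSpace ℝ (Fin M)) {t : ℝ}
    (h0 : 0 ≤ t) (h1 : t ≤ 1) :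
    qNorm q ((1 - t) • a + t • b) ≤ (1 - t) * qNorm q a + t * qNorm q b := by
  have : Fact (1 ≤ q) := ⟨hq⟩
  simp only [qNorm, WithLp.ofLp_add, WithLp.ofLp_smul, WithLp.toLp_add, WithLp.toLp_smul]
  refine (norm_add_le _ _).trans ?_
  rw [norm_smul_of_nonneg (by linarith), norm_smul_of_nonneg h0]

/-- Every coordinate is at most the `q`-norm. The factor `M` is crude but uniform in `q`; it
accounts for the later hypotheses `c * M ≤ v l`. -/
theorem norm_le_mul_qNorm {q : ℝ≥0∞} (hq : 1 ≤ q) (x : EuclideanSpace ℝ (Fin M)) :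
    ‖x‖ ≤ M * qNorm q x := by
  have : Fact (1 ≤ q) := ⟨hq⟩
  calc ‖x‖ = ‖∑ i, EuclideanSpace.single i (x i)‖ := by
        congr 1
        ext j
        simp [Finset.sum_apply, Pi.single_apply]
    _ ≤ ∑ i, ‖EuclideanSpace.single i (x i)‖ := norm_sum_le _ _
    _ ≤ ∑ _i : Fin M, qNorm q x := Finset.sum_le_sum fun i _ => by
        rw [PiLp.norm_single]
        exact PiLp.norm_apply_le (WithLp.toLp q (WithLp.ofLp x)) i
    _ = M * qNorm q x := by simp

theorem hasSum_norm_sq (u : Coeff Λ M) : HasSum (fun l => ‖u l‖ ^ 2) (‖u‖ ^ 2) := by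
  simpa using lp.hasSum_norm (p := 2) (by norm_num) u

theorem ofReal_mul_norm_sq (u : Coeff Λ M) {γ : ℝ} (hγ : 0 ≤ γ) :
    ENNReal.ofReal (γ * ‖u‖ ^ 2) = ∑' l, ENNReal.ofReal (γ * ‖u l‖ ^ 2) := by
  have h := (hasSum_norm_sq u).mul_left γ
  rw [← ENNReal.ofReal_tsum_of_nonneg (fun l => by positivity) h.summable, h.tsum_eq]

/-- The triangle inequality for the expansion of `u` into its one-index pieces: the `ℓ₁` norm
dominates the `ℓ₂` norm. -/
theorem ofReal_mul_norm_le_tsum (u : Coeff Λ M) {c : ℝ} (hc : 0 ≤ c) :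
    ENNReal.ofReal (c * ‖u‖) ≤ ∑' l, ENNReal.ofReal (c * ‖u l‖) := by
  classical
  simp only [ENNReal.ofReal_mul hc, ofReal_norm, ENNReal.tsum_mul_left]
  gcongr
  calc ‖u‖ₑ = ‖∑' l, lp.single 2 l (u l)‖ₑ := by
        rw [(lp.hasSum_single (by norm_num) u).tsum_eq]
    _ ≤ ∑' l, ‖(lp.single 2 l (u l) : Coeff Λ M)‖ₑ := enorm_tsum_le_tsum_enorm
    _ = ∑' l, ‖u l‖ₑ := by
        congr 1
        ext l
        rw [← ofReal_norm, lp.norm_single (by norm_num), ofReal_norm]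

variable {q : ℝ≥0∞} {v ω : Λ → ℝ}

theorem Psi_zero (hq : 1 ≤ q) : Psi q v ω (0 : Coeff Λ M) = 0 := by
  simp [Psi, qNorm_zero hq]

theorem lowerSemicontinuous_Psi (hq : 1 ≤ q) :
    LowerSemicontinuous (Psi q v ω : Coeff Λ M → ℝ≥0∞) := by
  refine LowerSemicontinuous.add (lowerSemicontinuous_tsum fun l => Continuous.lowerSemicontinuous ?_)
    (lowerSemicontinuous_tsum fun l => Continuous.lowerSemicontinuous ?_)
  · exact ENNReal.continuous_ofReal.comp
      (continuous_const.mul ((continuous_qNorm hq).comp (continuous_coeff_apply l)))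
  · exact ENNReal.continuous_ofReal.comp
      (continuous_const.mul ((continuous_coeff_apply l).norm.pow 2))

/-- Holds term by term: the `q`-norms are convex, and the squared Euclidean norms satisfy an exact
identity whose defect is weighted by `ω l ≥ γ`. -/
theorem stronglyConvex_Psi (hq : 1 ≤ q) (hv : ∀ l, 0 ≤ v l) {γ : ℝ} (hγ : 0 ≤ γ)
    (hω : ∀ l, γ ≤ ω l) : StronglyConvex γ (Psi q v ω : Coeff Λ M → ℝ≥0∞) := by
  intro a b t h0 h1
  have h1' : 0 ≤ 1 - t := by linarith
  have htt : 0 ≤ t * (1 - t) := mul_nonneg h0 h1'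
  have hω0 : ∀ l, 0 ≤ ω l := fun l => hγ.trans (hω l)
  have hQ := fun x : EuclideanSpace ℝ (Fin M) => qNorm_nonneg hq x
  rw [ofReal_mul_norm_sq _ (by positivity)]
  simp only [Psi]
  rw [add_assoc, ← ENNReal.tsum_add (f := fun l => ENNReal.ofReal (ω l *
      ‖((1 - t) • a + t • b : Coeff Λ M) l‖ ^ 2)), mul_add, mul_add, add_add_add_comm,
    ← ENNReal.tsum_mul_left, ← ENNReal.tsum_mul_left, ← ENNReal.tsum_mul_left,
    ← ENNReal.tsum_mul_left]
  refine (add_le_add (ENNReal.tsum_le_tsum fun l => ?_)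
    (ENNReal.tsum_le_tsum fun l => ?_)).trans_eq
      (congrArg₂ (· + ·) ENNReal.tsum_add ENNReal.tsum_add)
  · have := hQ (a l)
    have := hQ (b l)
    have := hv l
    rw [← ENNReal.ofReal_mul h1', ← ENNReal.ofReal_mul h0,
      ← ENNReal.ofReal_add (by positivity) (by positivity)]
    apply ENNReal.ofReal_le_ofReal
    have h := mul_le_mul_of_nonneg_left (qNorm_convex_combination hq (a l) (b l) h0 h1) (hv l)
    simp only [lp.coeFn_add, lp.coeFn_smul, Pi.add_apply, Pi.smul_apply]
    linarith
  · have := hω0 l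
    rw [← ENNReal.ofReal_mul h1', ← ENNReal.ofReal_mul h0,
      ← ENNReal.ofReal_add (by positivity) (by positivity),
      ← ENNReal.ofReal_add (by positivity) (by positivity)]
    apply ENNReal.ofReal_le_ofReal
    have h := congrArg (ω l * ·) (norm_sq_convex_combination (a l) (b l) t)
    have h2 := mul_le_mul_of_nonneg_right (hω l) (mul_nonneg htt (sq_nonneg ‖a l - b l‖))
    simp only [lp.coeFn_add, lp.coeFn_sub, lp.coeFn_smul, Pi.add_apply, Pi.sub_apply,
      Pi.smul_apply] at h ⊢
    linarith

theorem ofReal_mul_norm_sq_le_Psi {γ : ℝ} (hγ : 0 ≤ γ) (hω : ∀ l, γ ≤ ω l) (u : Coeff Λ M) :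
    ENNReal.ofReal (γ * ‖u‖ ^ 2) ≤ Psi q v ω u := by
  rw [ofReal_mul_norm_sq u hγ]
  refine le_trans (ENNReal.tsum_le_tsum fun l => ENNReal.ofReal_le_ofReal ?_) le_add_self
  exact mul_le_mul_of_nonneg_right (hω l) (sq_nonneg _)

open Classical in
/-- The family that agrees with `u` on `S` and vanishes elsewhere. -/
noncomputable def truncate (S : Finset Λ) (u : Coeff Λ M) : Coeff Λ M := ∑ l ∈ S, lp.single 2 l (u l)

open Classical in
theorem truncate_apply (S : Finset Λ) (u : Coeff Λ M) (l : Λ) :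
    truncate S u l = if l ∈ S then u l else 0 := by
  simp only [truncate, lp.coeFn_sum, Finset.sum_apply, lp.single_apply, Pi.single_apply]
  split_ifs with h
  · rw [Finset.sum_eq_single l]
    · simp
    · intro b _ hb; simp [hb.symm]
    · exact fun h' => absurd h h'
  · refine Finset.sum_eq_zero fun b hb => ?_
    rw [if_neg]
    rintro rfl
    exact h hb

theorem tendsto_truncate (u : Coeff Λ M) :
    Filter.Tendsto (fun S => truncate S u) Filter.atTop (nhds u) := by
  classical
  convert! lp.hasSum_single (by norm_num) u

theorem inner_truncate_sub_truncate (S : Finset Λ) (p z : Coeff Λ M) :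
    inner ℝ (truncate S p) (z - truncate S z) = 0 := by
  classical
  rw [lp.inner_eq_tsum]
  convert tsum_zero with l
  rw [lp.coeFn_sub, Pi.sub_apply, truncate_apply, truncate_apply]
  split_ifs <;> simp

/-- Deleting a tail saves a linear amount, its `ℓ₁` norm times `c`. Near zero this beats any
sufficiently small linear gain in the data term. -/
theorem Psi_truncate_add_le (hq : 1 ≤ q) {c : ℝ} (hc : 0 ≤ c) (hv : ∀ l, c * M ≤ v l)
    (hω : ∀ l, 0 ≤ ω l) (S : Finset Λ) (u : Coeff Λ M) :
    Psi q v ω (truncate S u) + ENNReal.ofReal (c * ‖u - truncate S u‖) ≤ Psi q v ω u := by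
  classical
  refine (add_le_add_right (ofReal_mul_norm_le_tsum _ hc) _).trans ?_
  simp only [Psi]
  rw [add_right_comm, ← ENNReal.tsum_add]
  refine add_le_add (ENNReal.tsum_le_tsum fun l => ?_)
    (ENNReal.tsum_le_tsum fun l => ENNReal.ofReal_le_ofReal ?_)
  · rw [lp.coeFn_sub, Pi.sub_apply, truncate_apply]
    split_ifs
    · simp
    · simp only [qNorm_zero hq, mul_zero, ENNReal.ofReal_zero, zero_add, sub_zero]
      apply ENNReal.ofReal_le_ofReal
      calc c * ‖u l‖ ≤ c * (M * qNorm q (u l)) := by gcongr; exact norm_le_mul_qNorm hq _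
        _ = c * M * qNorm q (u l) := by ring
        _ ≤ _ := mul_le_mul_of_nonneg_right (hv l) (qNorm_nonneg hq _)
  · rw [truncate_apply]
    split_ifs
    · rfl
    · simpa using mul_nonneg (hω l) (sq_nonneg _)

theorem ofReal_mul_norm_le_Psi (hq : 1 ≤ q) {c : ℝ} (hc : 0 ≤ c) (hv : ∀ l, c * M ≤ v l)
    (hω : ∀ l, 0 ≤ ω l) (u : Coeff Λ M) : ENNReal.ofReal (c * ‖u‖) ≤ Psi q v ω u := by
  have h := Psi_truncate_add_le hq hc hv hω ∅ u
  simp only [truncate, Finset.sum_empty, sub_zero] at h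
  exact le_add_self.trans h

/-- If the residual `x - z` at the thresholding `z` of `x` is close to a vector whose tail outside
`S` is small, then `z` is supported in `S`. -/
theorem truncate_eq_of_isMinOn_proxFunctional (hq : 1 ≤ q) {c : ℝ} (hc : 0 ≤ c)
    (hv : ∀ l, c * M ≤ v l) (hω : ∀ l, 0 ≤ ω l) {x z p : Coeff Λ M} {S : Finset Λ}
    (hz : IsMinOn (proxFunctional q v ω x) Set.univ z) (hfin : Psi q v ω z ≠ ∞)
    (hp : 2 * ‖x - z - p‖ + 2 * ‖p - truncate S p‖ < c) : truncate S z = z := by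
  have hv0 : ∀ l, 0 ≤ v l := fun l => le_trans (by positivity) (hv l)
  have hconv : StronglyConvex (1 + 0) (proxFunctional q v ω x) :=
    (stronglyConvex_norm_sub_sq x).add zero_le_one le_rfl (stronglyConvex_Psi hq hv0 le_rfl hω)
  have h1 := hconv.growth (by norm_num) hz (by simp [proxFunctional, hfin]) (truncate S z)
  have h2 := Psi_truncate_add_le hq hc hv hω S z
  have hfin' : Psi q v ω (truncate S z) ≠ ∞ :=
    ne_top_of_le_ne_top hfin (le_self_add.trans h2)
  simp only [proxFunctional] at h1
  rw [← ENNReal.ofReal_toReal hfin, ← ENNReal.ofReal_toReal hfin'] at h1 h2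
  set a := (Psi q v ω z).toReal
  set b := (Psi q v ω (truncate S z)).toReal
  have ha : 0 ≤ a := ENNReal.toReal_nonneg
  have hb : 0 ≤ b := ENNReal.toReal_nonneg
  rw [← ENNReal.ofReal_add (by positivity) ha, ← ENNReal.ofReal_add (by positivity) hb,
    ← ENNReal.ofReal_add (by positivity) (by positivity),
    ENNReal.ofReal_le_ofReal_iff (by positivity)] at h1
  rw [← ENNReal.ofReal_add hb (by positivity), ENNReal.ofReal_le_ofReal_iff ha] at h2
  set d := z - truncate S z with hd
  have e : x - truncate S z = (x - z) + d := by rw [hd]; abel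
  have e' : ‖truncate S z - z‖ = ‖d‖ := norm_sub_rev _ _
  rw [e, e', norm_add_sq_real] at h1
  -- The growth term cancels `‖d‖²`, so `h1` and `h2` give `c‖d‖ ≤ 2⟨x - z, d⟩`. The part of `p` on
  -- `S` is orthogonal to `d`, so only the tail of `p` and the error `x - z - p` contribute.
  have h3 : inner ℝ (x - z) d = inner ℝ (x - z - p) d + inner ℝ (p - truncate S p) d := by
    rw [inner_sub_left p, inner_truncate_sub_truncate, sub_zero, ← inner_add_left, sub_add_cancel]
  have h4 := real_inner_le_norm (x - z - p) d
  have h5 := real_inner_le_norm (p - truncate S p) d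
  have h6 : c * ‖d‖ ≤ (2 * ‖x - z - p‖ + 2 * ‖p - truncate S p‖) * ‖d‖ := by linarith
  have h7 : ‖d‖ = 0 := by
    by_contra hne
    have hpos : 0 < ‖d‖ := lt_of_le_of_ne (norm_nonneg _) (Ne.symm hne)
    exact absurd (le_of_mul_le_mul_right h6 hpos) (not_le.2 hp)
  exact (sub_eq_zero.1 (norm_eq_zero.1 h7)).symm

/-- A bounded sequence of families supported in a common finite set has a convergent
subsequence. -/
theorem exists_tendsto_subseq_of_truncate_eq {S : Finset Λ} {u : ℕ → Coeff Λ M} {R : ℝ}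
    (hR : ∀ n, ‖u n‖ ≤ R) (hS : ∀ n, truncate S (u n) = u n) :
    ∃ w, ∃ φ : ℕ → ℕ, StrictMono φ ∧ Filter.Tendsto (u ∘ φ) Filter.atTop (nhds w) := by
  classical
  let y : ℕ → (S → EuclideanSpace ℝ (Fin M)) := fun n l => u n l
  have hR0 : 0 ≤ R := (norm_nonneg _).trans (hR 0)
  have hy : ∀ n, y n ∈ Metric.closedBall (0 : S → EuclideanSpace ℝ (Fin M)) R := by
    intro n
    rw [mem_closedBall_zero_iff, pi_norm_le_iff_of_nonneg hR0]
    exact fun l => (lp.norm_apply_le_norm two_ne_zero (u n) l).trans (hR n)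
  obtain ⟨y₀, -, φ, hφ, hlim⟩ := tendsto_subseq_of_bounded Metric.isBounded_closedBall hy
  refine ⟨∑ l : S, lp.single 2 (l : Λ) (y₀ l), φ, hφ, ?_⟩
  have e : u ∘ φ = fun n => ∑ l : S, lp.single 2 (l : Λ) ((y ∘ φ) n l) := by
    ext1 n
    rw [Function.comp_apply, ← hS (φ n), truncate, ← Finset.sum_coe_sort]
    simp only [y, Function.comp_apply]
  rw [e]
  refine tendsto_finsetSum _ fun l _ => ?_
  have hc : Continuous (lp.single (E := fun _ : Λ => EuclideanSpace ℝ (Fin M)) 2 (l : Λ)) :=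
    (lp.isometry_single (l : Λ)).continuous
  exact (hc.tendsto _).comp ((tendsto_pi_nhds.1 hlim) l)

end Concrete

end JointSparsity

namespace JointSparsity

/-! ### Convergence of Landweber sequences in Hilbert space -/

section Convergence

theorem one_sub_norm_sq_pos {V : Type*} [SeminormedAddGroup V] {x : V} (hx : ‖x‖ < 1) :
    0 < 1 - ‖x‖ ^ 2 := by
  nlinarith [norm_nonneg x]

variable {E H : Type*} [NormedAddCommGroup E] [InnerProductSpace ℝ E] [CompleteSpace E]
  [NormedAddCommGroup H] [InnerProductSpace ℝ H] [CompleteSpace H]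

/-- A sequence of thresholded Landweber iterates for the convex functional `Ψ`. -/
def IsLandweberSequence (Ψ : E → ℝ≥0∞) (T : E →L[ℝ] H) (g : H) (u : ℕ → E) : Prop :=
  ∀ m, IsMinOn (fun z => ENNReal.ofReal
    (‖u m + ContinuousLinearMap.adjoint T (g - T (u m)) - z‖ ^ 2) + Ψ z) Set.univ (u (m + 1))

variable {γ : ℝ} {Ψ : E → ℝ≥0∞} {T : E →L[ℝ] H} {g : H} {u : ℕ → E} {uStar : E}

/-- The decreasing sequence `a` converges, so its decrements, which dominate `ε‖w m‖²`, tend to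
zero. -/
theorem tendsto_zero_of_norm_sq_le {V : Type*} [SeminormedAddCommGroup V] {a : ℕ → ℝ} {w : ℕ → V}
    {ε : ℝ} (hε : 0 < ε) (ha : ∀ m, 0 ≤ a m) (h : ∀ m, a (m + 1) + ε * ‖w m‖ ^ 2 ≤ a m) :
    Filter.Tendsto w Filter.atTop (nhds 0) := by
  have hanti : Antitone a := antitone_nat_of_succ_le fun m => by
    nlinarith [h m, mul_nonneg hε.le (sq_nonneg ‖w m‖)]
  have hlim := tendsto_atTop_ciInf hanti ⟨0, by rintro _ ⟨m, rfl⟩; exact ha m⟩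
  have hdiff := (hlim.sub ((Filter.tendsto_add_atTop_iff_nat 1).2 hlim)).div_const ε
  rw [sub_self, zero_div] at hdiff
  have hsq : Filter.Tendsto (fun m => ‖w m‖ ^ 2) Filter.atTop (nhds 0) :=
    squeeze_zero (fun m => sq_nonneg _)
      (fun m => by rw [le_div_iff₀ hε]; linarith [h m]) hdiff
  have := hsq.sqrt
  simp only [Real.sqrt_sq (norm_nonneg _), Real.sqrt_zero] at this
  exact tendsto_zero_iff_norm_tendsto_zero.2 this

/-- If `Ψ` is strongly convex, the iterates converge to the minimizer. -/
theorem IsLandweberSequence.tendsto_of_pos (hγ : 0 < γ) (hΨ : StronglyConvex γ Ψ) (hT : ‖T‖ < 1)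
    (hu : IsLandweberSequence Ψ T g u)
    (hs : IsMinOn (fun z => ENNReal.ofReal (‖T z - g‖ ^ 2) + Ψ z) Set.univ uStar)
    (hst : Ψ uStar ≠ ∞) : Filter.Tendsto u Filter.atTop (nhds uStar) := by
  have h : ∀ m, ‖u (m + 1) - uStar‖ ^ 2 + γ * ‖u (m + 1) - uStar‖ ^ 2 ≤ ‖u m - uStar‖ ^ 2 := by
    intro m
    have h1 := (landweber_step hγ.le hΨ T hT g (hu m) hs hst).2.1
    have h2 := mul_nonneg (one_sub_norm_sq_pos hT).le (sq_nonneg ‖u (m + 1) - u m‖)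
    have h3 := sq_nonneg ‖T (u m - uStar)‖
    linarith
  have h0 := tendsto_zero_of_norm_sq_le (w := fun m => u (m + 1) - uStar) hγ
    (fun m => sq_nonneg ‖u m - uStar‖) h
  exact (Filter.tendsto_add_atTop_iff_nat 1).1 (tendsto_sub_nhds_zero_iff.1 h0)

theorem IsLandweberSequence.antitone_norm_sub (hΨ : StronglyConvex 0 Ψ) (hT : ‖T‖ < 1)
    (hu : IsLandweberSequence Ψ T g u)
    (hs : IsMinOn (fun z => ENNReal.ofReal (‖T z - g‖ ^ 2) + Ψ z) Set.univ uStar)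
    (hst : Ψ uStar ≠ ∞) :
    Antitone fun m => ‖u m - uStar‖ := by
  refine antitone_nat_of_succ_le fun m => ?_
  have h1 := (landweber_step le_rfl hΨ T hT g (hu m) hs hst).2.1
  have h2 := mul_nonneg (one_sub_norm_sq_pos hT).le (sq_nonneg ‖u (m + 1) - u m‖)
  have h3 := sq_nonneg ‖T (u m - uStar)‖
  exact (sq_le_sq₀ (norm_nonneg _) (norm_nonneg _)).1 (by linarith)

theorem IsLandweberSequence.tendsto_succ_sub (hΨ : StronglyConvex 0 Ψ) (hT : ‖T‖ < 1)
    (hu : IsLandweberSequence Ψ T g u)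
    (hs : IsMinOn (fun z => ENNReal.ofReal (‖T z - g‖ ^ 2) + Ψ z) Set.univ uStar)
    (hst : Ψ uStar ≠ ∞) :
    Filter.Tendsto (fun m => u (m + 1) - u m) Filter.atTop (nhds 0) := by
  refine tendsto_zero_of_norm_sq_le (one_sub_norm_sq_pos hT)
    (fun m => sq_nonneg ‖u m - uStar‖) fun m => ?_
  have h1 := (landweber_step le_rfl hΨ T hT g (hu m) hs hst).2.1
  have h3 := sq_nonneg ‖T (u m - uStar)‖
  linarith

theorem IsLandweberSequence.tendsto_map (hΨ : StronglyConvex 0 Ψ) (hT : ‖T‖ < 1)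
    (hu : IsLandweberSequence Ψ T g u)
    (hs : IsMinOn (fun z => ENNReal.ofReal (‖T z - g‖ ^ 2) + Ψ z) Set.univ uStar)
    (hst : Ψ uStar ≠ ∞) :
    Filter.Tendsto (fun m => T (u m)) Filter.atTop (nhds (T uStar)) := by
  rw [← tendsto_sub_nhds_zero_iff]
  refine tendsto_zero_of_norm_sq_le one_pos (fun m => sq_nonneg ‖u m - uStar‖) fun m => ?_
  have h1 := (landweber_step le_rfl hΨ T hT g (hu m) hs hst).2.1
  have h2 := mul_nonneg (one_sub_norm_sq_pos hT).le (sq_nonneg ‖u (m + 1) - u m‖)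
  rw [map_sub] at h1
  linarith

/-- The residuals `x⁽ᵐ⁾ - u⁽ᵐ⁺¹⁾` of the thresholding steps converge in norm. -/
theorem IsLandweberSequence.tendsto_residual (hΨ : StronglyConvex 0 Ψ) (hT : ‖T‖ < 1)
    (hu : IsLandweberSequence Ψ T g u)
    (hs : IsMinOn (fun z => ENNReal.ofReal (‖T z - g‖ ^ 2) + Ψ z) Set.univ uStar)
    (hst : Ψ uStar ≠ ∞) :
    Filter.Tendsto (fun m => u m + ContinuousLinearMap.adjoint T (g - T (u m)) - u (m + 1))
      Filter.atTop (nhds (ContinuousLinearMap.adjoint T (g - T uStar))) := by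
  have h1 := hu.tendsto_succ_sub hΨ hT hs hst
  have h2 := ((ContinuousLinearMap.adjoint T).continuous.tendsto _).comp
    ((hu.tendsto_map hΨ hT hs hst).const_sub g)
  have h3 := h2.sub h1
  rw [sub_zero] at h3
  refine h3.congr fun m => ?_
  simp only [Function.comp_apply]
  abel

/-- A strong cluster point of the iterates is a minimizer. -/
theorem IsLandweberSequence.isMinOn_of_subseq (hΨ : StronglyConvex 0 Ψ) (hT : ‖T‖ < 1)
    (hu : IsLandweberSequence Ψ T g u)
    (hs : IsMinOn (fun z => ENNReal.ofReal (‖T z - g‖ ^ 2) + Ψ z) Set.univ uStar)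
    (hst : Ψ uStar ≠ ∞)
    (hlsc : LowerSemicontinuous Ψ) {φ : ℕ → ℕ} (hφ : StrictMono φ) {w : E}
    (hw : Filter.Tendsto (fun n => u (φ n + 1)) Filter.atTop (nhds w)) :
    IsMinOn (fun z => ENNReal.ofReal (‖T z - g‖ ^ 2) + Ψ z) Set.univ w := by
  have hKlsc : LowerSemicontinuous fun z => ENNReal.ofReal (‖T z - g‖ ^ 2) + Ψ z :=
    LowerSemicontinuous.add (Continuous.lowerSemicontinuous
      (ENNReal.continuous_ofReal.comp (((T.continuous.sub continuous_const).norm).pow 2))) hlsc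
  have hanti : Antitone fun m => ‖u m - uStar‖ ^ 2 := fun k n hkn =>
    pow_le_pow_left₀ (norm_nonneg _) (hu.antitone_norm_sub hΨ hT hs hst hkn) 2
  have hlim := tendsto_atTop_ciInf hanti ⟨0, by rintro _ ⟨m, rfl⟩; exact sq_nonneg _⟩
  have hdiff := hlim.sub ((Filter.tendsto_add_atTop_iff_nat 1).2 hlim)
  rw [sub_self] at hdiff
  have hval := ((ENNReal.tendsto_ofReal hdiff).const_add
    (ENNReal.ofReal (‖T uStar - g‖ ^ 2) + Ψ uStar)).comp hφ.tendsto_atTop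
  rw [ENNReal.ofReal_zero, add_zero] at hval
  -- Along the subsequence, `K` exceeds its minimum by at most a decrement of `‖u m - uStar‖²`,
  -- which vanishes; lower semicontinuity passes this to `w`.
  have hle : ENNReal.ofReal (‖T w - g‖ ^ 2) + Ψ w ≤
      ENNReal.ofReal (‖T uStar - g‖ ^ 2) + Ψ uStar := by
    refine le_of_forall_lt fun r hr => ?_
    obtain ⟨s, hrs, hs'⟩ := exists_between hr
    refine hrs.trans_le (ge_of_tendsto hval ?_)
    filter_upwards [hw.eventually (hKlsc w s hs')] with n hn
    exact hn.le.trans (landweber_step le_rfl hΨ T hT g (hu (φ n)) hs hst).2.2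
  exact fun z hz => hle.trans (hs hz)

/-- If the iterates have a strongly convergent subsequence, they converge to a minimizer. -/
theorem IsLandweberSequence.tendsto_of_subseq (hΨ : StronglyConvex 0 Ψ) (hT : ‖T‖ < 1)
    (hu : IsLandweberSequence Ψ T g u)
    (hs : IsMinOn (fun z => ENNReal.ofReal (‖T z - g‖ ^ 2) + Ψ z) Set.univ uStar)
    (hst : Ψ uStar ≠ ∞)
    (hlsc : LowerSemicontinuous Ψ) {φ : ℕ → ℕ} (hφ : StrictMono φ) {w : E}
    (hw : Filter.Tendsto (fun n => u (φ n + 1)) Filter.atTop (nhds w)) :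
    Filter.Tendsto u Filter.atTop (nhds w) := by
  have hmin := hu.isMinOn_of_subseq hΨ hT hs hst hlsc hφ hw
  have hfin : Ψ w ≠ ∞ := by
    have h := isMinOn_iff.1 hmin uStar trivial
    exact (ENNReal.add_ne_top.1 (ne_top_of_le_ne_top (by simp [hst]) h)).2
  -- Since `w` is itself a minimizer, the distances to `w` decrease, and they tend to zero along a
  -- subsequence.
  have hanti := hu.antitone_norm_sub hΨ hT hmin hfin
  rw [tendsto_iff_norm_sub_tendsto_zero] at hw ⊢
  have hlim := tendsto_atTop_ciInf hanti ⟨0, by rintro _ ⟨m, rfl⟩; exact norm_nonneg _⟩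
  have hsub := hlim.comp ((Filter.tendsto_add_atTop_nat 1).comp hφ.tendsto_atTop)
  rwa [tendsto_nhds_unique hsub hw] at hlim

end Convergence

/-! ### Existence of minimizers and the two cases of the theorem -/

section Main

variable {Λ : Type*} {M : ℕ} {q : ℝ≥0∞} {v ω : Λ → ℝ}
  {H : Type*} [NormedAddCommGroup H] [InnerProductSpace ℝ H] {T : Coeff Λ M →L[ℝ] H} {g : H}

theorem exists_isMinOn_proxFunctional (hq : 1 ≤ q) (hv : ∀ l, 0 ≤ v l) (hω : ∀ l, 0 ≤ ω l)
    (x : Coeff Λ M) : ∃ z, IsMinOn (proxFunctional q v ω x) Set.univ z := by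
  have hconv : StronglyConvex (1 + 0) (proxFunctional q v ω x) :=
    (stronglyConvex_norm_sub_sq x).add zero_le_one le_rfl (stronglyConvex_Psi hq hv le_rfl hω)
  refine exists_isMinOn_of_convex (a := 0) (LowerSemicontinuous.add
    (Continuous.lowerSemicontinuous (ENNReal.continuous_ofReal.comp (by fun_prop)))
    (lowerSemicontinuous_Psi hq)) hconv.convex_sublevel
    (by simp [proxFunctional, Psi_zero hq]) fun r hr => ⟨‖x‖ + (r.toReal + 1), fun z hz => ?_⟩
  have h1 : ‖x - z‖ ^ 2 ≤ r.toReal := (ENNReal.ofReal_le_iff_le_toReal hr).1 (le_self_add.trans hz)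
  have h2 : ‖z‖ ≤ ‖x‖ + ‖x - z‖ := by
    simpa using norm_sub_le x (x - z)
  nlinarith [sq_nonneg (‖x - z‖ - 1)]

theorem existsUnique_isMinOn_proxFunctional (hq : 1 ≤ q) (hv : ∀ l, 0 ≤ v l) (hω : ∀ l, 0 ≤ ω l)
    (x : Coeff Λ M) : ∃! z, IsMinOn (proxFunctional q v ω x) Set.univ z := by
  obtain ⟨z, hz⟩ := exists_isMinOn_proxFunctional hq hv hω x
  have hconv : StronglyConvex (1 + 0) (proxFunctional q v ω x) :=
    (stronglyConvex_norm_sub_sq x).add zero_le_one le_rfl (stronglyConvex_Psi hq hv le_rfl hω)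
  refine ⟨z, hz, fun w hw => hconv.isMinOn_unique (by norm_num) hz hw ?_⟩
  exact ne_top_of_le_ne_top (by simp [proxFunctional, Psi_zero hq]) (isMinOn_iff.1 hz 0 trivial)

theorem exists_isMinOn_K (hq : 1 ≤ q) (hv : ∀ l, 0 ≤ v l) (hω : ∀ l, 0 ≤ ω l)
    (hbdd : ∀ r : ℝ≥0∞, r ≠ ∞ → ∃ R : ℝ, ∀ u : Coeff Λ M, Psi q v ω u ≤ r → ‖u‖ ≤ R) :
    ∃ z, IsMinOn (K q v ω T g) Set.univ z ∧ Psi q v ω z ≠ ∞ := by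
  have hconv : StronglyConvex (0 + 0) (K q v ω T g) :=
    (stronglyConvex_norm_map_sub_sq T g).add le_rfl le_rfl (stronglyConvex_Psi hq hv le_rfl hω)
  obtain ⟨z, hz⟩ := exists_isMinOn_of_convex (F := K q v ω T g) (a := 0) (LowerSemicontinuous.add
    (Continuous.lowerSemicontinuous (ENNReal.continuous_ofReal.comp (by fun_prop)))
    (lowerSemicontinuous_Psi hq)) hconv.convex_sublevel
    (by simp [K, Psi_zero hq]) fun r hr => (hbdd r hr).imp fun R hR u hu =>
      hR u (le_add_self.trans hu)
  have h := isMinOn_iff.1 hz 0 trivial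
  exact ⟨z, hz, (ENNReal.add_ne_top.1
    (ne_top_of_le_ne_top (by simp [K, Psi_zero hq]) h)).2⟩

variable [CompleteSpace H]

theorem isLandweberSequence_iterate (hq : 1 ≤ q) (hv : ∀ l, 0 ≤ v l) (hω : ∀ l, 0 ≤ ω l)
    (u0 : Coeff Λ M) : IsLandweberSequence (Psi q v ω) T g (iterate q v ω T g u0) := fun _ =>
  Classical.epsilon_spec (exists_isMinOn_proxFunctional hq hv hω _)

theorem exists_tendsto_iterate_of_quadratic (hq : 1 ≤ q) (hv : ∀ l, 0 ≤ v l) (hT : ‖T‖ < 1)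
    (hω : BoundedAwayFromZero ω) (u0 : Coeff Λ M) :
    ∃ uStar, IsMinOn (K q v ω T g) Set.univ uStar ∧
      Filter.Tendsto (iterate q v ω T g u0) Filter.atTop (nhds uStar) := by
  obtain ⟨γ, hγ, hωγ⟩ := hω
  have hω0 : ∀ l, 0 ≤ ω l := fun l => hγ.le.trans (hωγ l)
  obtain ⟨z, hz, hzt⟩ := exists_isMinOn_K (T := T) (g := g) hq hv hω0
    fun r hr => ⟨r.toReal / γ + 1, fun u hu => by
      have h := (ENNReal.ofReal_le_iff_le_toReal hr).1
        ((ofReal_mul_norm_sq_le_Psi hγ.le hωγ u).trans hu)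
      rw [mul_comm, ← le_div_iff₀ hγ] at h
      nlinarith [sq_nonneg (‖u‖ - 1)]⟩
  exact ⟨z, hz, (isLandweberSequence_iterate hq hv hω0 u0).tendsto_of_pos hγ
    (stronglyConvex_Psi hq hv hγ.le hωγ) hT hz hzt⟩

theorem exists_tendsto_iterate_of_sparse (hq : 1 ≤ q) (hω : ∀ l, 0 ≤ ω l) (hT : ‖T‖ < 1)
    (hv : BoundedAwayFromZero v) (u0 : Coeff Λ M) :
    ∃ uStar, IsMinOn (K q v ω T g) Set.univ uStar ∧
      Filter.Tendsto (iterate q v ω T g u0) Filter.atTop (nhds uStar) := by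
  obtain ⟨c', hc', hvc'⟩ := hv
  obtain ⟨c, hc, hvc⟩ : ∃ c : ℝ, 0 < c ∧ ∀ l, c * M ≤ v l := by
    -- Dividing by `M + 1` rather than `M` also covers `M = 0`.
    refine ⟨c' / (M + 1), by positivity, fun l => le_trans ?_ (hvc' l)⟩
    rw [div_mul_eq_mul_div, div_le_iff₀ (by positivity)]
    linarith
  have hv0 : ∀ l, 0 ≤ v l := fun l => hc'.le.trans (hvc' l)
  obtain ⟨z, hz, hzt⟩ := exists_isMinOn_K (T := T) (g := g) hq hv0 hω
    fun r hr => ⟨r.toReal / c, fun u hu => by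
      rw [le_div_iff₀ hc, mul_comm]
      exact (ENNReal.ofReal_le_iff_le_toReal hr).1
        ((ofReal_mul_norm_le_Psi hq hc.le hvc hω u).trans hu)⟩
  have hconv : StronglyConvex 0 (Psi q v ω : Coeff Λ M → ℝ≥0∞) :=
    stronglyConvex_Psi hq hv0 le_rfl hω
  have hu := isLandweberSequence_iterate (T := T) (g := g) hq hv0 hω u0
  set u := iterate q v ω T g u0
  have hres := hu.tendsto_residual hconv hT hz hzt
  set p := ContinuousLinearMap.adjoint T (g - T z)
  -- Two errors below `c / 4`, each counted twice, stay below the threshold `c`.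
  obtain ⟨S, hS⟩ : ∃ S, ‖p - truncate S p‖ < c / 4 := by
    have h := (tendsto_truncate p).eventually (Metric.ball_mem_nhds p (ε := c / 4) (by positivity))
    obtain ⟨S, hS⟩ := h.exists
    exact ⟨S, by rwa [dist_comm, dist_eq_norm] at hS⟩
  obtain ⟨N, hN⟩ := Filter.eventually_atTop.1
    (hres.eventually (Metric.ball_mem_nhds p (ε := c / 4) (by positivity)))
  -- The residual with index `n + N` belongs to the iterate `n + N + 1`.
  have hsupp : ∀ n, truncate S (u (n + N + 1)) = u (n + N + 1) := by
    intro n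
    have h := hN (n + N) (by omega)
    rw [dist_eq_norm] at h
    exact truncate_eq_of_isMinOn_proxFunctional hq hc.le hvc hω (hu (n + N))
      (landweber_step le_rfl hconv T hT g (hu (n + N)) hz hzt).1 (by linarith)
  obtain ⟨w, φ, hφ, hw⟩ := exists_tendsto_subseq_of_truncate_eq (R := ‖z‖ + ‖u 0 - z‖)
    (fun n => by
      have h1 := hu.antitone_norm_sub hconv hT hz hzt (Nat.zero_le (n + N + 1))
      have h2 := norm_add_le z (u (n + N + 1) - z)
      rw [add_sub_cancel] at h2
      exact h2.trans (by gcongr)) hsupp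
  have hφN : StrictMono fun n => φ n + N := hφ.add_const N
  exact ⟨w, hu.isMinOn_of_subseq hconv hT hz hzt (lowerSemicontinuous_Psi hq) hφN hw,
    hu.tendsto_of_subseq hconv hT hz hzt (lowerSemicontinuous_Psi hq) hφN hw⟩

end Main

end JointSparsity

theorem mainTheorem5 {Λ : Type*} [Countable Λ] {M : ℕ}
    {H : Type*} [NormedAddCommGroup H] [InnerProductSpace ℝ H] [CompleteSpace H]
    (q : ENNReal) (hq : 1 ≤ q)
    (v ω : Λ → ℝ) (hv : ∀ l, 0 ≤ v l) (hω : ∀ l, 0 ≤ ω l)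
    (T : JointSparsity.Coeff Λ M →L[ℝ] H) (hT : ‖T‖ < 1) (g : H)
    (hbdd : JointSparsity.BoundedAwayFromZero v ∨ JointSparsity.BoundedAwayFromZero ω)
    (hfin : ¬ JointSparsity.BoundedAwayFromZero v →
      ∃ c : ℝ, 0 < c ∧ {l : Λ | v l < c}.Finite) :
    (∀ x : JointSparsity.Coeff Λ M,
      ∃! z, IsMinOn (JointSparsity.proxFunctional q v ω x) Set.univ z) ∧
    ∀ u0 : JointSparsity.Coeff Λ M, ∃ uStar : JointSparsity.Coeff Λ M,
      IsMinOn (JointSparsity.K q v ω T g) Set.univ uStar ∧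
      Filter.Tendsto (JointSparsity.iterate q v ω T g u0) Filter.atTop (nhds uStar) := by
  have hprox := JointSparsity.existsUnique_isMinOn_proxFunctional (M := M) hq hv hω
  refine ⟨hprox, fun u0 => ?_⟩
  rcases hbdd with h | h
  · exact JointSparsity.exists_tendsto_iterate_of_sparse hq hω hT h u0
  · exact JointSparsity.exists_tendsto_iterate_of_quadratic hq hv hT h u0
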